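/- **Theorem (EC-GP-UCB regret with known $\epsilon$).** For all $\sigma\ge 0$ and $\lambda>0$ there is a constant $C>0$, depending only on $\sigma$ and $\lambda$, such that the following holds. *Setting.* Let $\mathcal D\subset\mathbb R^d$ be compact and let $k:\mathcal D\times\mathcal D\to\mathbb R$ be a measurable positive (semi)definite kernel with $k(x,x)\le 1$ for all $x\in\mathcal D$, with reproducing kernel Hilbert space $\mathcal H_k$ and norm $\|\cdot\|_k$. Let $B>0$, $\epsilon\ge 0$, $\delta\in(0,1)$, $T\in\mathbb N$, and let $f^*:\mathcal D\to\mathbb R$ be any function for which there is $\tilde f\in\mathcal H_k$ with $\|\tilde f\|_k\le B$ and $\sup_{x\in\mathcal D}|\tilde f(x)-f^*(x)|\le\epsilon$; fix any such $\tilde f$ (for instance a minimizer of $\|f-f^*\|_\infty$ over $\|f\|_k\le B$). *Observations.* In round $t=1,\dots,T$ a point $x_t\in\mathcal D$ is selected, and then $y^*_t=f^*(x_t)+\eta_t$ is observed. There is a filtration $(\mathcal G_t)_{t\ge0}$ such that, for $1\le t\le T$, $x_t$ is $\mathcal G_{t-1}$-measurable, $\eta_t$ is $\mathcal G_t$-measurable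 and independent of $\mathcal G_{t-1}$ (so the noise is independent over rounds), and $\eta_t$ is $\sigma$-sub-Gaussian, i.e. $\mathbb E\,e^{s\eta_t}\le e^{\sigma^2s^2/2}$ for all $s\in\mathbb R$ (hence $\mathbb E\,\eta_t=0$). *Algorithm.* For points $x_1,\dots,x_t$ put $K_t=[k(x_i,x_j)]_{i,j\le t}$, $k_t(x)=[k(x_1,x),\dots,k(x_t,x)]^\top$, $Y^*_t=(y^*_1,\dots,y^*_t)^\top$ and $$\mu^*_t(x)=k_t(x)^\top(K_t+\lambda I_t)^{-1}Y^*_t,\qquad \sigma_t^2(x)=k(x,x)-k_t(x)^\top(K_t+\lambda I_t)^{-1}k_t(x),$$ $$\beta_t=\frac{\sigma}{\sqrt\lambda}\Big(2\ln(1/\delta)+\sum_{s=1}^{t-1}\ln\big(1+\lambda^{-1}\sigma_{s-1}^2(x_s)\big)\Big)^{1/2}+B .$$ In each round $t\le T$, EC-GP-UCB selects a maximizer $$x_t\in\operatorname*{arg\,max}_{x\in\mathcal D}\ \mu^*_{t-1}(x)+\Big(\beta_t+\frac{\epsilon\sqrt t}{\sqrt\lambda}\Big)\sigma_{t-1}(x).$$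 *Conclusion.* Let $\gamma_T=\sup_{z_1,\dots,z_T\in\mathcal D}\tfrac12\ln\det\big(I_T+\lambda^{-1}[k(z_i,z_j)]_{i,j\le T}\big)$ be the maximum information gain (repeated points allowed), and let $R_T=\sum_{t=1}^T\big(\sup_{x\in\mathcal D}\tilde f(x)-\tilde f(x_t)\big)$. Then, with probability at least $1-\delta$, $$R_T\le C\Big(B\sqrt{\gamma_TT}+\sqrt{(\ln(1/\delta)+\gamma_T)\,\gamma_TT}+\epsilon\,T\sqrt{\gamma_T}\Big).$$ -/

import Mathlib

open MeasureTheory ProbabilityTheory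
open scoped NNReal ENNReal Matrix

noncomputable section

namespace GPBandit

variable {X : Type*}

/-- The Hilbert space `H` of real functions on `X` is the reproducing kernel Hilbert space of the
kernel `k`. (An operator `ℝ →L[ℝ] ℝ` is identified with its value at `1`. In particular `k` is
symmetric and positive semidefinite.) -/
def IsRKHSOf (k : X → X → ℝ) (H : Type*) [NormedAddCommGroup H] [InnerProductSpace ℝ H]
    [CompleteSpace H] [RKHS ℝ H X ℝ] : Prop :=
  ∀ x y : X, RKHS.kernel H x y 1 = k x y

/-- The ball of radius `B` in the Hilbert space of functions `H`. -/
def hypothesisClass (H : Type*) [NormedAddCommGroup H] (B : ℝ) : Set H :=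
  {f | ‖f‖ ≤ B}

/-- The kernel matrix `K_n` of the points `x_1, …, x_n`. -/
def kernelMatrix (k : X → X → ℝ) {n : ℕ} (x : Fin n → X) : Matrix (Fin n) (Fin n) ℝ :=
  Matrix.of fun i j => k (x i) (x j)

/-- The vector `k_n(z) = (k(x_1, z), …, k(x_n, z))`. -/
def kernelVec (k : X → X → ℝ) {n : ℕ} (x : Fin n → X) (z : X) : Fin n → ℝ :=
  fun i => k (x i) z

/-- Posterior mean `k_n(z)ᵀ (K_n + lam I)⁻¹ y` at `z`, given the observations `y` at `x`. -/
def posteriorMean (k : X → X → ℝ) (lam : ℝ) {n : ℕ} (x : Fin n → X) (y : Fin n → ℝ) (z : X) : ℝ :=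
  kernelVec k x z ⬝ᵥ
    ((kernelMatrix k x + lam • (1 : Matrix (Fin n) (Fin n) ℝ))⁻¹ *ᵥ y)

/-- Posterior variance `k(z,z) - k_n(z)ᵀ (K_n + lam I)⁻¹ k_n(z)` at `z`. -/
def posteriorVar (k : X → X → ℝ) (lam : ℝ) {n : ℕ} (x : Fin n → X) (z : X) : ℝ :=
  k z z - kernelVec k x z ⬝ᵥ
    ((kernelMatrix k x + lam • (1 : Matrix (Fin n) (Fin n) ℝ))⁻¹ *ᵥ kernelVec k x z)

/-- Posterior standard deviation at `z`. -/
def posteriorStd (k : X → X → ℝ) (lam : ℝ) {n : ℕ} (x : Fin n → X) (z : X) : ℝ :=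
  √(posteriorVar k lam x z)

/-- The maximum information gain
`γ_n = max over x_1, …, x_n of (1/2) ln det (I_n + lam⁻¹ K_n)`; points may be repeated. -/
def maxInfoGain (k : X → X → ℝ) (lam : ℝ) (n : ℕ) : ℝ :=
  ⨆ x : Fin n → X,
    (1 / 2 : ℝ) * Real.log (1 + lam⁻¹ • kernelMatrix k x : Matrix (Fin n) (Fin n) ℝ).det

/-- The first `n` terms of a sequence. -/
def firstTerms {α : Type*} (a : ℕ → α) (n : ℕ) : Fin n → α := fun i => a i

/-- The confidence parameter used after the first `n` rounds, i.e. `β_{n+1}`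
(rounds are counted from `0` in the code, so that `x s` is the point `x_{s+1}`):
`β_{n+1} = (σ / √lam) (2 ln(1/δ) + ∑_{s=1}^{n} ln(1 + lam⁻¹ σ_{s-1}²(x_s)))^{1/2} + B`. -/
def confidenceParam (k : X → X → ℝ) (lam σ B δ : ℝ) (x : ℕ → X) (n : ℕ) : ℝ :=
  σ / √lam * √(2 * Real.log (1 / δ) +
    ∑ s ∈ Finset.range n, Real.log (1 + lam⁻¹ * posteriorVar k lam (firstTerms x s) (x s))) + B

/-- The upper confidence bound with enlarged confidence width at the point `z` in round `n + 1`: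
`μ*_n(z) + (β_{n+1} + ε √(n+1) / √lam) σ_n(z)`, computed from the points `x` and the
observations `y` of the first `n` rounds. -/
def enlargedUCB (k : X → X → ℝ) (lam σ B δ ε : ℝ) (x : ℕ → X) (y : ℕ → ℝ) (n : ℕ) (z : X) : ℝ :=
  posteriorMean k lam (firstTerms x n) (firstTerms y n) z +
    (confidenceParam k lam σ B δ x n + ε * √((n : ℝ) + 1) / √lam) *
      posteriorStd k lam (firstTerms x n) z

/-- The points `x` are selected by EC-GP-UCB during the first `T` rounds, when the observations
are `y`: in every round the selected point is a maximizer of the enlarged upper confidence bound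
(with an arbitrary choice between several maximizers). -/
def IsECGPUCBRun (k : X → X → ℝ) (lam σ B δ ε : ℝ) (T : ℕ) (x : ℕ → X) (y : ℕ → ℝ) : Prop :=
  ∀ n < T, ∀ z : X,
    enlargedUCB k lam σ B δ ε x y n z ≤ enlargedUCB k lam σ B δ ε x y n (x n)

/-- Cumulative regret over `T` rounds with respect to the reward function `f`. -/
def cumRegret (f : X → ℝ) (x : ℕ → X) (T : ℕ) : ℝ :=
  ∑ t ∈ Finset.range T, ((⨆ z : X, f z) - f (x t))

/-- Interaction protocol over `T` rounds: `ℱ t` is the information that is available when the point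
of round `t` (counted from `0`) is selected. The selected point depends on that information only;
the noise of round `t` is independent of it, is known afterwards, and is `σ`-sub-Gaussian,
`E exp(s η) ≤ exp(σ² s² / 2)` for all real `s` (this forces mean zero). In particular the noise
variables are independent over the rounds. -/
structure IsBanditProtocol {Ω : Type*} [mΩ : MeasurableSpace Ω] [MeasurableSpace X]
    (P : Measure Ω) (ℱ : Filtration ℕ mΩ) (σ : ℝ≥0) (T : ℕ)
    (x : ℕ → Ω → X) (η : ℕ → Ω → ℝ) : Prop where
  point_measurable : ∀ t < T, Measurable[ℱ t] (x t)
  noise_measurable : ∀ t < T, Measurable[ℱ (t + 1)] (η t)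
  noise_indep : ∀ t < T, Indep (MeasurableSpace.comap (η t) inferInstance) (ℱ t) P
  noise_subGaussian : ∀ t < T, HasSubgaussianMGF (η t) (σ ^ 2) P

end GPBandit

end

/-! Write `k a b = ⟪φ a, φ b⟫`. The posterior mean at `z` is linear in the observations, with
weights `α = (K + λI)⁻¹ k_n(z)`, and `posteriorVar_eq_norm` gives `σ_n²(z) = ‖φ z - ∑ α_i φ(x_i)‖² +
λ|α|²`. The first summand controls the bias of noiseless data, by `B σ_n(z)`. The second controls
the effect of errors of size `ε`, by `ε √n σ_n(z) / √λ`. Both together control the noise, by `√Q_n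
σ_n(z) / √λ`, where `Q_n` is the self-normalized form of the noise.

It remains to bound `Q_n` uniformly in `n`. When a point with posterior variance `v` and predicted
noise `m` is added, `Q_n` grows by `η² - c(η - m)²`, `c = λ/(λ + v)`. The exponential moment of this
increment over `2σ²` is at most `1/√c = √(1 + v/λ)`, whatever `m` is, and this is exactly the growth
of `√det(I + λ⁻¹K)`. So `exp(Q_n/(2σ²))/√det(I + λ⁻¹K_n)` is a supermartingale started at 1, and
Ville's inequality at level `1/δ` gives the confidence event.

On that event the enlarged index is an upper bound for `f`, so the regret of a round is at most
twice the confidence width times `σ_n(x_n)`. Cauchy–Schwarz over the rounds, with `∑ σ_n²(x_n) ≤ 2(λ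
+ 1)γ_T`, finishes the proof. -/

namespace GPBandit

/-! ### Kernel ridge regression in feature space -/

variable {X E : Type*} [NormedAddCommGroup E] [InnerProductSpace ℝ E]

/-- The regularized kernel matrix `K_n + lam I`. -/
def regularizedMatrix (k : X → X → ℝ) (lam : ℝ) {n : ℕ} (x : Fin n → X) :
    Matrix (Fin n) (Fin n) ℝ :=
  kernelMatrix k x + lam • 1

/-- The weights `(K_n + lam I)⁻¹ k_n(z)` of the observations in the posterior mean at `z`. -/
noncomputable def posteriorWeights (k : X → X → ℝ) (lam : ℝ) {n : ℕ} (x : Fin n → X) (z : X) :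
    Fin n → ℝ :=
  (regularizedMatrix k lam x)⁻¹ *ᵥ kernelVec k x z

/-- The self-normalized quadratic form `yᵀ K_n (K_n + lam I)⁻¹ y`, written as
`yᵀ y - lam yᵀ (K_n + lam I)⁻¹ y`. -/
noncomputable def selfNormalizedForm (k : X → X → ℝ) (lam : ℝ) {n : ℕ} (x : Fin n → X)
    (y : Fin n → ℝ) : ℝ :=
  y ⬝ᵥ y - lam * (y ⬝ᵥ ((regularizedMatrix k lam x)⁻¹ *ᵥ y))

variable {k : X → X → ℝ} {φ : X → E} {lam : ℝ} {n : ℕ}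

lemma kernelMatrix_mulVec (hk : ∀ a b, k a b = inner ℝ (φ a) (φ b)) (x : Fin n → X)
    (w : Fin n → ℝ) (i : Fin n) :
    (kernelMatrix k x *ᵥ w) i = inner ℝ (φ (x i)) (∑ j, w j • φ (x j)) := by
  simp [Matrix.mulVec, dotProduct, kernelMatrix, hk, inner_sum, inner_smul_right, mul_comm]

lemma dotProduct_kernelMatrix_mulVec (hk : ∀ a b, k a b = inner ℝ (φ a) (φ b)) (x : Fin n → X)
    (v w : Fin n → ℝ) :
    v ⬝ᵥ (kernelMatrix k x *ᵥ w) = inner ℝ (∑ i, v i • φ (x i)) (∑ j, w j • φ (x j)) := by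
  simp only [dotProduct, kernelMatrix_mulVec hk, sum_inner, real_inner_smul_left]

lemma kernelVec_dotProduct (hk : ∀ a b, k a b = inner ℝ (φ a) (φ b)) (x : Fin n → X)
    (w : Fin n → ℝ) (z : X) :
    kernelVec k x z ⬝ᵥ w = inner ℝ (φ z) (∑ j, w j • φ (x j)) := by
  simp only [dotProduct, kernelVec, hk, inner_sum, real_inner_smul_right]
  exact Finset.sum_congr rfl fun i _ => by rw [real_inner_comm, mul_comm]

lemma regularizedMatrix_mulVec (x : Fin n → X) (w : Fin n → ℝ) :
    regularizedMatrix k lam x *ᵥ w = kernelMatrix k x *ᵥ w + lam • w := by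
  simp [regularizedMatrix, Matrix.add_mulVec, Matrix.smul_mulVec]

lemma isUnit_det_regularizedMatrix (hk : ∀ a b, k a b = inner ℝ (φ a) (φ b)) (hlam : 0 < lam)
    (x : Fin n → X) : IsUnit (regularizedMatrix k lam x).det := by
  rw [isUnit_iff_ne_zero]
  intro h
  obtain ⟨w, hw, hw'⟩ := Matrix.exists_mulVec_eq_zero_iff.2 h
  have h1 : w ⬝ᵥ (regularizedMatrix k lam x *ᵥ w) = 0 := by rw [hw', dotProduct_zero]
  rw [regularizedMatrix_mulVec, dotProduct_add, dotProduct_kernelMatrix_mulVec hk,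
    real_inner_self_eq_norm_sq, dotProduct_smul, smul_eq_mul] at h1
  have h2 : 0 < w ⬝ᵥ w := lt_of_le_of_ne
    (Finset.sum_nonneg fun i _ => mul_self_nonneg (w i))
    fun h => hw (dotProduct_self_eq_zero.1 h.symm)
  nlinarith [mul_pos hlam h2, sq_nonneg ‖∑ i, w i • φ (x i)‖]

lemma regularizedMatrix_mulVec_inv (hk : ∀ a b, k a b = inner ℝ (φ a) (φ b)) (hlam : 0 < lam)
    (x : Fin n → X) (w : Fin n → ℝ) :
    regularizedMatrix k lam x *ᵥ ((regularizedMatrix k lam x)⁻¹ *ᵥ w) = w := by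
  rw [Matrix.mulVec_mulVec, Matrix.mul_nonsing_inv _ (isUnit_det_regularizedMatrix hk hlam x),
    Matrix.one_mulVec]

lemma eq_inv_mulVec (hk : ∀ a b, k a b = inner ℝ (φ a) (φ b)) (hlam : 0 < lam)
    {x : Fin n → X} {v w : Fin n → ℝ} (h : regularizedMatrix k lam x *ᵥ v = w) :
    (regularizedMatrix k lam x)⁻¹ *ᵥ w = v := by
  rw [← h, Matrix.mulVec_mulVec, Matrix.nonsing_inv_mul _ (isUnit_det_regularizedMatrix hk hlam x),
    Matrix.one_mulVec]

lemma dotProduct_regularizedMatrix_inv_comm (hk : ∀ a b, k a b = inner ℝ (φ a) (φ b))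
    (x : Fin n → X) (v w : Fin n → ℝ) :
    v ⬝ᵥ ((regularizedMatrix k lam x)⁻¹ *ᵥ w) = ((regularizedMatrix k lam x)⁻¹ *ᵥ v) ⬝ᵥ w := by
  have hT : (regularizedMatrix k lam x)ᵀ = regularizedMatrix k lam x := by
    ext i j
    simp [regularizedMatrix, kernelMatrix, hk, Matrix.one_apply, real_inner_comm, eq_comm]
  rw [Matrix.dotProduct_mulVec, ← Matrix.mulVec_transpose, Matrix.transpose_nonsing_inv, hT]

/-- Symmetry of `K + λI` moves the inverse onto `k_n(z)`; linearity in `y` then lets signal,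
misspecification and noise be treated separately. -/
lemma posteriorMean_eq_weights (hk : ∀ a b, k a b = inner ℝ (φ a) (φ b))
    (x : Fin n → X) (y : Fin n → ℝ) (z : X) :
    posteriorMean k lam x y z = posteriorWeights k lam x z ⬝ᵥ y :=
  dotProduct_regularizedMatrix_inv_comm hk x _ y

lemma posteriorVar_eq_kernelVec (x : Fin n → X) (z : X) :
    posteriorVar k lam x z = k z z - kernelVec k x z ⬝ᵥ posteriorWeights k lam x z := rfl

/-- The posterior variance is a regularized squared distance of `φ z` from the span of the
features of the observed points. -/
lemma posteriorVar_eq_norm (hk : ∀ a b, k a b = inner ℝ (φ a) (φ b)) (hlam : 0 < lam)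
    (x : Fin n → X) (z : X) :
    posteriorVar k lam x z =
      ‖φ z - ∑ i, posteriorWeights k lam x z i • φ (x i)‖ ^ 2 +
        lam * (posteriorWeights k lam x z ⬝ᵥ posteriorWeights k lam x z) := by
  -- The normal equations `(K + λI)α = k_n(z)`, paired with `α`; they evaluate the cross term of the
  -- expanded square.
  have h : posteriorWeights k lam x z ⬝ᵥ (regularizedMatrix k lam x *ᵥ posteriorWeights k lam x z)
      = posteriorWeights k lam x z ⬝ᵥ kernelVec k x z := by
    rw [posteriorWeights, regularizedMatrix_mulVec_inv hk hlam]
  rw [regularizedMatrix_mulVec, dotProduct_add, dotProduct_kernelMatrix_mulVec hk,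
    real_inner_self_eq_norm_sq, dotProduct_smul, smul_eq_mul, dotProduct_comm _ (kernelVec k x z),
    kernelVec_dotProduct hk] at h
  rw [posteriorVar_eq_kernelVec, kernelVec_dotProduct hk, norm_sub_sq_real, hk,
    real_inner_self_eq_norm_sq]
  linarith

lemma posteriorVar_nonneg (hk : ∀ a b, k a b = inner ℝ (φ a) (φ b)) (hlam : 0 < lam)
    (x : Fin n → X) (z : X) : 0 ≤ posteriorVar k lam x z := by
  rw [posteriorVar_eq_norm hk hlam]
  have : 0 ≤ posteriorWeights k lam x z ⬝ᵥ posteriorWeights k lam x z :=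
    Finset.sum_nonneg fun i _ => mul_self_nonneg _
  positivity

lemma posteriorVar_le (hk : ∀ a b, k a b = inner ℝ (φ a) (φ b)) (hlam : 0 < lam)
    (x : Fin n → X) (z : X) : posteriorVar k lam x z ≤ k z z := by
  have h : kernelVec k x z ⬝ᵥ posteriorWeights k lam x z =
      (regularizedMatrix k lam x *ᵥ posteriorWeights k lam x z) ⬝ᵥ posteriorWeights k lam x z := by
    rw [posteriorWeights, regularizedMatrix_mulVec_inv hk hlam]
  rw [dotProduct_comm, regularizedMatrix_mulVec, add_dotProduct, dotProduct_comm (_ *ᵥ _),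
    dotProduct_kernelMatrix_mulVec hk, real_inner_self_eq_norm_sq, smul_dotProduct, smul_eq_mul,
    dotProduct_comm] at h
  have : 0 ≤ posteriorWeights k lam x z ⬝ᵥ posteriorWeights k lam x z :=
    Finset.sum_nonneg fun i _ => mul_self_nonneg _
  rw [posteriorVar_eq_kernelVec, h]
  nlinarith [mul_nonneg hlam.le this, sq_nonneg ‖∑ i, posteriorWeights k lam x z i • φ (x i)‖]

/-- The posterior mean of noiseless evaluations `⟪f, φ (x i)⟫` approximates `⟪f, φ z⟫`. -/
lemma abs_posteriorMean_inner_sub_le (hk : ∀ a b, k a b = inner ℝ (φ a) (φ b)) (hlam : 0 < lam)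
    (x : Fin n → X) (f : E) (z : X) :
    |posteriorMean k lam x (fun i => inner ℝ f (φ (x i))) z - inner ℝ f (φ z)| ≤
      ‖f‖ * posteriorStd k lam x z := by
  have h : posteriorMean k lam x (fun i => inner ℝ f (φ (x i))) z - inner ℝ f (φ z) =
      -inner ℝ f (φ z - ∑ i, posteriorWeights k lam x z i • φ (x i)) := by
    rw [posteriorMean_eq_weights hk, inner_sub_right, inner_sum]
    simp [dotProduct, inner_smul_right]
  rw [h, abs_neg]
  refine (abs_real_inner_le_norm _ _).trans (mul_le_mul_of_nonneg_left ?_ (norm_nonneg _))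
  apply Real.le_sqrt_of_sq_le
  rw [posteriorVar_eq_norm hk hlam]
  have : 0 ≤ posteriorWeights k lam x z ⬝ᵥ posteriorWeights k lam x z :=
    Finset.sum_nonneg fun i _ => mul_self_nonneg _
  nlinarith

/-- Observation errors of size at most `ε` move the posterior mean by at most
`ε √n / √lam` posterior standard deviations. -/
lemma abs_posteriorMean_le_of_abs_le (hk : ∀ a b, k a b = inner ℝ (φ a) (φ b)) (hlam : 0 < lam)
    (x : Fin n → X) (e : Fin n → ℝ) {ε : ℝ} (hε : 0 ≤ ε) (he : ∀ i, |e i| ≤ ε) (z : X) :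
    |posteriorMean k lam x e z| ≤ ε * √n / √lam * posteriorStd k lam x z := by
  rw [posteriorMean_eq_weights hk, posteriorStd]
  refine abs_le_of_sq_le_sq ?_ (by positivity)
  have h1 : (posteriorWeights k lam x z ⬝ᵥ e) ^ 2 ≤
      (posteriorWeights k lam x z ⬝ᵥ posteriorWeights k lam x z) * (n * ε ^ 2) := by
    refine (Finset.sum_mul_sq_le_sq_mul_sq _ _ _).trans ?_
    simp only [dotProduct, ← sq]
    refine mul_le_mul_of_nonneg_left ?_ (Finset.sum_nonneg fun i _ => sq_nonneg _)
    refine (Finset.sum_le_card_nsmul _ _ (ε ^ 2) fun i _ => ?_).trans (by simp)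
    exact sq_le_sq' (abs_le.1 (he i)).1 (abs_le.1 (he i)).2
  have h2 := posteriorVar_eq_norm hk hlam x z
  rw [mul_pow, div_pow, mul_pow, Real.sq_sqrt (by positivity), Real.sq_sqrt hlam.le,
    Real.sq_sqrt (posteriorVar_nonneg hk hlam x z)]
  refine h1.trans ?_
  rw [div_mul_eq_mul_div, le_div_iff₀ hlam, h2]
  have : 0 ≤ ε ^ 2 * n * ‖φ z - ∑ i, posteriorWeights k lam x z i • φ (x i)‖ ^ 2 := by positivity
  linarith

/-- Substituting `y = (K + λI)w` exhibits the form as a sum of squares, parallel to the one for the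
posterior variance, so that the two can be paired by Cauchy–Schwarz. -/
lemma selfNormalizedForm_eq (hk : ∀ a b, k a b = inner ℝ (φ a) (φ b)) (hlam : 0 < lam)
    (x : Fin n → X) {y w : Fin n → ℝ} (hw : (regularizedMatrix k lam x)⁻¹ *ᵥ y = w) :
    selfNormalizedForm k lam x y =
      (kernelMatrix k x *ᵥ w) ⬝ᵥ (kernelMatrix k x *ᵥ w) + lam * ‖∑ i, w i • φ (x i)‖ ^ 2 := by
  have hy : y = kernelMatrix k x *ᵥ w + lam • w := by
    rw [← regularizedMatrix_mulVec, ← hw, regularizedMatrix_mulVec_inv hk hlam]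
  rw [selfNormalizedForm, hw, ← real_inner_self_eq_norm_sq, ← dotProduct_kernelMatrix_mulVec hk, hy]
  simp only [add_dotProduct, dotProduct_add, smul_dotProduct, dotProduct_smul, smul_eq_mul,
    dotProduct_comm w]
  ring

lemma selfNormalizedForm_nonneg (hk : ∀ a b, k a b = inner ℝ (φ a) (φ b)) (hlam : 0 < lam)
    (x : Fin n → X) (y : Fin n → ℝ) : 0 ≤ selfNormalizedForm k lam x y := by
  rw [selfNormalizedForm_eq hk hlam x rfl]
  exact add_nonneg (Finset.sum_nonneg fun i _ => mul_self_nonneg _) (by positivity)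

/-- The posterior mean is bounded by the posterior standard deviation and the self-normalized
form of the observations. -/
lemma abs_posteriorMean_le (hk : ∀ a b, k a b = inner ℝ (φ a) (φ b)) (hlam : 0 < lam)
    (x : Fin n → X) (y : Fin n → ℝ) (z : X) :
    |posteriorMean k lam x y z| ≤
      √(selfNormalizedForm k lam x y) / √lam * posteriorStd k lam x z := by
  set w := (regularizedMatrix k lam x)⁻¹ *ᵥ y with hw
  set α := posteriorWeights k lam x z with hα
  set u := kernelMatrix k x *ᵥ w with hu
  set h := ∑ i, w i • φ (x i) with hh
  set r := φ z - ∑ i, α i • φ (x i) with hr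
  -- The mean is `⟪φ z, h⟫`; split `φ z` into the residual `r` and its approximation by the observed
  -- features.
  have hm : posteriorMean k lam x y z = inner ℝ r h + α ⬝ᵥ u := by
    rw [hu, dotProduct_kernelMatrix_mulVec hk, ← inner_add_left, hr, sub_add_cancel, hh,
      ← kernelVec_dotProduct hk]
    rfl
  have h1 : |inner ℝ r h| ≤ ‖r‖ * ‖h‖ := abs_real_inner_le_norm _ _
  have h2 : (α ⬝ᵥ u) ^ 2 ≤ (α ⬝ᵥ α) * (u ⬝ᵥ u) := by
    refine (Finset.sum_mul_sq_le_sq_mul_sq _ _ _).trans (le_of_eq ?_)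
    simp only [dotProduct, ← sq]
  have ha : 0 ≤ α ⬝ᵥ α := Finset.sum_nonneg fun i _ => mul_self_nonneg _
  have hb : 0 ≤ u ⬝ᵥ u := Finset.sum_nonneg fun i _ => mul_self_nonneg _
  have h3 : |α ⬝ᵥ u| ≤ √(α ⬝ᵥ α) * √(u ⬝ᵥ u) := by
    rw [← Real.sqrt_mul ha]; exact Real.abs_le_sqrt h2
  rw [posteriorStd]
  refine abs_le_of_sq_le_sq ?_ (by positivity)
  rw [mul_pow, div_pow, Real.sq_sqrt (selfNormalizedForm_nonneg hk hlam x y), Real.sq_sqrt hlam.le,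
    Real.sq_sqrt (posteriorVar_nonneg hk hlam x z), posteriorVar_eq_norm hk hlam x z,
    selfNormalizedForm_eq hk hlam x hw.symm, ← hα, ← hu, ← hh, ← hr, hm, div_mul_eq_mul_div,
    le_div_iff₀ hlam]
  have h4 : (inner ℝ r h + α ⬝ᵥ u) ^ 2 ≤ (‖r‖ * ‖h‖ + √(α ⬝ᵥ α) * √(u ⬝ᵥ u)) ^ 2 := by
    refine sq_le_sq' ?_ ?_ <;> linarith [abs_le.1 h1, abs_le.1 h3, neg_le_abs (inner ℝ r h),
      neg_le_abs (α ⬝ᵥ u), le_abs_self (inner ℝ r h), le_abs_self (α ⬝ᵥ u)]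
  refine (mul_le_mul_of_nonneg_right h4 hlam.le).trans ?_
  obtain ⟨a, hae⟩ : ∃ a, a = √(α ⬝ᵥ α) := ⟨_, rfl⟩
  obtain ⟨b, hbe⟩ : ∃ b, b = √(u ⬝ᵥ u) := ⟨_, rfl⟩
  rw [← Real.sq_sqrt ha, ← Real.sq_sqrt hb, Real.sqrt_sq (Real.sqrt_nonneg _),
    Real.sqrt_sq (Real.sqrt_nonneg _), ← hae, ← hbe]
  -- The difference of the two sides is exactly this square: Cauchy–Schwarz in the plane with weight
  -- `λ`.
  linarith [sq_nonneg (‖r‖ * b - lam * a * ‖h‖)]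

/-- Block elimination: the new coordinate `r` is the prediction residual over the Schur complement
`λ + v`, and the old ones are corrected by `r` times the weights of the new point. The solution is
checked by multiplying out. -/
lemma regularizedMatrix_succ_inv_mulVec (hk : ∀ a b, k a b = inner ℝ (φ a) (φ b)) (hlam : 0 < lam)
    (x : ℕ → X) (y : ℕ → ℝ) (n : ℕ) {r : ℝ}
    (hr : r = (y n - posteriorMean k lam (firstTerms x n) (firstTerms y n) (x n)) /
      (lam + posteriorVar k lam (firstTerms x n) (x n))) :
    (regularizedMatrix k lam (firstTerms x (n + 1)))⁻¹ *ᵥ firstTerms y (n + 1) =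
      Fin.snoc (α := fun _ => ℝ)
        ((regularizedMatrix k lam (firstTerms x n))⁻¹ *ᵥ firstTerms y n -
          r • posteriorWeights k lam (firstTerms x n) (x n)) r := by
  apply eq_inv_mulVec hk hlam
  have hv := posteriorVar_nonneg hk hlam (firstTerms x n) (x n)
  set w := (regularizedMatrix k lam (firstTerms x n))⁻¹ *ᵥ firstTerms y n with hw
  set α := posteriorWeights k lam (firstTerms x n) (x n) with hα
  have hw' : regularizedMatrix k lam (firstTerms x n) *ᵥ (w - r • α) =
      firstTerms y n - r • kernelVec k (firstTerms x n) (x n) := by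
    rw [Matrix.mulVec_sub, Matrix.mulVec_smul, hw, hα, posteriorWeights,
      regularizedMatrix_mulVec_inv hk hlam, regularizedMatrix_mulVec_inv hk hlam]
  rw [regularizedMatrix_mulVec] at hw' ⊢
  have hcomm : ∀ a b, k a b = k b a := fun a b => by rw [hk, hk, real_inner_comm]
  ext i
  refine Fin.lastCases ?_ (fun i => ?_) i
  · have h1 : kernelVec k (firstTerms x n) (x n) ⬝ᵥ (w - r • α) =
        posteriorMean k lam (firstTerms x n) (firstTerms y n) (x n) -
          r * (k (x n) (x n) - posteriorVar k lam (firstTerms x n) (x n)) := by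
      rw [dotProduct_sub, dotProduct_smul, posteriorVar_eq_kernelVec, smul_eq_mul, sub_sub_cancel]
      rfl
    have h2 : (kernelMatrix k (firstTerms x (n + 1)) *ᵥ
        Fin.snoc (α := fun _ => ℝ) (w - r • α) r) (Fin.last n) =
        kernelVec k (firstTerms x n) (x n) ⬝ᵥ (w - r • α) + k (x n) (x n) * r := by
      simp only [Matrix.mulVec, dotProduct, Fin.sum_univ_castSucc, Fin.snoc_castSucc, Fin.snoc_last]
      congr 1
      refine Finset.sum_congr rfl fun j _ => ?_
      congr 1
      exact hcomm _ _
    rw [Pi.add_apply, h2, h1, Pi.smul_apply, Fin.snoc_last, smul_eq_mul]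
    have h3 : r * (lam + posteriorVar k lam (firstTerms x n) (x n)) =
        y n - posteriorMean k lam (firstTerms x n) (firstTerms y n) (x n) := by
      rw [hr, div_mul_cancel₀]; positivity
    have h4 : firstTerms y (n + 1) (Fin.last n) = y n := by simp [firstTerms]
    rw [h4]
    linarith
  · have h2 : (kernelMatrix k (firstTerms x (n + 1)) *ᵥ
        Fin.snoc (α := fun _ => ℝ) (w - r • α) r) i.castSucc =
        (kernelMatrix k (firstTerms x n) *ᵥ (w - r • α)) i +
          kernelVec k (firstTerms x n) (x n) i * r := by
      simp only [Matrix.mulVec, dotProduct, Fin.sum_univ_castSucc, Fin.snoc_castSucc, Fin.snoc_last]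
      rfl
    have h3 := congrFun hw' i
    rw [Pi.add_apply, Pi.smul_apply] at h3 ⊢
    rw [h2, Fin.snoc_castSucc]
    have h4 : firstTerms y (n + 1) i.castSucc = firstTerms y n i := rfl
    rw [h4]
    simp only [Pi.sub_apply, Pi.smul_apply, smul_eq_mul] at h3 ⊢
    linarith

/-- The increment sees the past only through the posterior mean and variance at the new point, which
are known before the new noise is drawn. -/
lemma selfNormalizedForm_succ (hk : ∀ a b, k a b = inner ℝ (φ a) (φ b)) (hlam : 0 < lam)
    (x : ℕ → X) (y : ℕ → ℝ) (n : ℕ) :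
    selfNormalizedForm k lam (firstTerms x (n + 1)) (firstTerms y (n + 1)) =
      selfNormalizedForm k lam (firstTerms x n) (firstTerms y n) +
        ((y n) ^ 2 - lam * (y n - posteriorMean k lam (firstTerms x n) (firstTerms y n) (x n)) ^ 2 /
          (lam + posteriorVar k lam (firstTerms x n) (x n))) := by
  have hsnoc : firstTerms y (n + 1) = Fin.snoc (α := fun _ => ℝ) (firstTerms y n) (y n) := by
    ext i
    refine Fin.lastCases ?_ (fun i => ?_) i <;> simp [firstTerms]
  have hdot : ∀ (a b : Fin n → ℝ) (c d : ℝ), Fin.snoc (α := fun _ => ℝ) a c ⬝ᵥ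
      Fin.snoc (α := fun _ => ℝ) b d = a ⬝ᵥ b + c * d := fun a b c d => by
    simp [dotProduct, Fin.sum_univ_castSucc]
  rw [selfNormalizedForm, regularizedMatrix_succ_inv_mulVec hk hlam x y n rfl, hsnoc, hdot, hdot,
    dotProduct_sub, dotProduct_smul, dotProduct_comm _ (posteriorWeights _ _ _ _),
    ← posteriorMean_eq_weights hk, selfNormalizedForm, smul_eq_mul]
  ring

/-- The Schur complement of the old block is `λ + v`. -/
lemma det_regularizedMatrix_succ (hk : ∀ a b, k a b = inner ℝ (φ a) (φ b)) (hlam : 0 < lam)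
    (x : ℕ → X) (n : ℕ) :
    (regularizedMatrix k lam (firstTerms x (n + 1))).det =
      (regularizedMatrix k lam (firstTerms x n)).det *
        (lam + posteriorVar k lam (firstTerms x n) (x n)) := by
  have hcomm : ∀ a b, k a b = k b a := fun a b => by rw [hk, hk, real_inner_comm]
  let _ := Matrix.invertibleOfIsUnitDet _ (isUnit_det_regularizedMatrix hk hlam (firstTerms x n))
  have hblock : (regularizedMatrix k lam (firstTerms x (n + 1))).submatrix
      (finSumFinEquiv (m := n) (n := 1)) (finSumFinEquiv (m := n) (n := 1)) =
      Matrix.fromBlocks (regularizedMatrix k lam (firstTerms x n))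
        (Matrix.of fun i _ => kernelVec k (firstTerms x n) (x n) i)
        (Matrix.of fun _ i => kernelVec k (firstTerms x n) (x n) i)
        (Matrix.of fun _ _ => k (x n) (x n) + lam) := by
    ext i j
    rcases i with i | i <;> rcases j with j | j
    · simp [regularizedMatrix, kernelMatrix, firstTerms, Matrix.one_apply, Fin.ext_iff]
    · have : (i : ℕ) ≠ n := i.2.ne
      simp [regularizedMatrix, kernelMatrix, kernelVec, firstTerms, Fin.ext_iff, this]
    · have : n ≠ (j : ℕ) := j.2.ne'
      simp [regularizedMatrix, kernelMatrix, kernelVec, firstTerms, Fin.ext_iff, this,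
        hcomm (x n)]
    · simp [regularizedMatrix, kernelMatrix, firstTerms, Matrix.one_apply, Fin.ext_iff]
  rw [← Matrix.det_submatrix_equiv_self (finSumFinEquiv (m := n) (n := 1)), hblock,
    Matrix.det_fromBlocks₁₁]
  congr 1
  rw [Matrix.det_fin_one, posteriorVar_eq_kernelVec, Matrix.invOf_eq_nonsing_inv, Matrix.mul_assoc,
    Matrix.sub_apply, Matrix.mul_apply_eq_vecMul, Matrix.of_apply]
  have : Matrix.vecMul ((Matrix.of fun (_ : Fin 1) i => kernelVec k (firstTerms x n) (x n) i) 0)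
      ((regularizedMatrix k lam (firstTerms x n))⁻¹ *
        (Matrix.of fun i (_ : Fin 1) => kernelVec k (firstTerms x n) (x n) i)) 0 =
      kernelVec k (firstTerms x n) (x n) ⬝ᵥ posteriorWeights k lam (firstTerms x n) (x n) := rfl
  rw [this]
  ring

/-- Chain rule for the information gain: `I + λ⁻¹K = λ⁻¹(K + λI)`, and each of the `n` factors `λ⁻¹`
is absorbed by one Schur complement. -/
lemma log_det_one_add_eq_sum (hk : ∀ a b, k a b = inner ℝ (φ a) (φ b)) (hlam : 0 < lam)
    (x : ℕ → X) (n : ℕ) :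
    Real.log (1 + lam⁻¹ • kernelMatrix k (firstTerms x n) : Matrix (Fin n) (Fin n) ℝ).det =
      ∑ s ∈ Finset.range n,
        Real.log (1 + lam⁻¹ * posteriorVar k lam (firstTerms x s) (x s)) := by
  have hpos : ∀ s, 0 < 1 + lam⁻¹ * posteriorVar k lam (firstTerms x s) (x s) := fun s => by
    have := posteriorVar_nonneg hk hlam (firstTerms x s) (x s)
    positivity
  have hprod : (1 + lam⁻¹ • kernelMatrix k (firstTerms x n) : Matrix (Fin n) (Fin n) ℝ).det =
      ∏ s ∈ Finset.range n, (1 + lam⁻¹ * posteriorVar k lam (firstTerms x s) (x s)) := by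
    have h : (1 + lam⁻¹ • kernelMatrix k (firstTerms x n) : Matrix (Fin n) (Fin n) ℝ) =
        lam⁻¹ • regularizedMatrix k lam (firstTerms x n) := by
      rw [regularizedMatrix, smul_add, smul_smul, inv_mul_cancel₀ hlam.ne', one_smul, add_comm]
    rw [h, Matrix.det_smul, Fintype.card_fin]
    clear h
    induction n with
    | zero => simp
    | succ n ih =>
      have h : 1 + lam⁻¹ * posteriorVar k lam (firstTerms x n) (x n) =
          lam⁻¹ * (lam + posteriorVar k lam (firstTerms x n) (x n)) := by
        rw [mul_add, inv_mul_cancel₀ hlam.ne']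
      rw [Finset.prod_range_succ, ← ih, det_regularizedMatrix_succ hk hlam, h, pow_succ]
      ring
  rw [hprod, Real.log_prod fun s _ => (hpos s).ne']

end GPBandit

/-! ### Probabilistic tools: Gaussian mixtures, independence, Ville's inequality -/

namespace GPBandit

/-- Completing the square turns the tilted density into a constant times the Gaussian density with
mean `b/(1-a)` and variance `1/(1-a)`. -/
lemma lintegral_exp_quadratic_gaussianReal {a : ℝ} (ha : a < 1) (b : ℝ) :
    ∫⁻ g, ENNReal.ofReal (Real.exp (a * g ^ 2 / 2 + b * g)) ∂gaussianReal 0 1 =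
      ENNReal.ofReal ((√(1 - a))⁻¹ * Real.exp (b ^ 2 / (2 * (1 - a)))) := by
  have ha' : 0 < 1 - a := sub_pos.2 ha
  obtain ⟨v, hv⟩ : ∃ v : ℝ≥0, (v : ℝ) = (1 - a)⁻¹ := ⟨_, Real.coe_toNNReal _ (inv_pos.2 ha').le⟩
  have hv0 : v ≠ 0 := by
    rw [← NNReal.coe_ne_zero, hv]
    exact (inv_pos.2 ha').ne'
  have hpdf : ∀ g : ℝ, gaussianPDF 0 1 g * ENNReal.ofReal (Real.exp (a * g ^ 2 / 2 + b * g)) =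
      ENNReal.ofReal ((√(1 - a))⁻¹ * Real.exp (b ^ 2 / (2 * (1 - a)))) *
        gaussianPDF (b / (1 - a)) v g := fun g => by
    rw [gaussianPDF, gaussianPDF, ← ENNReal.ofReal_mul (gaussianPDFReal_nonneg _ _ _),
      ← ENNReal.ofReal_mul (by positivity)]
    congr 1
    simp only [gaussianPDFReal, NNReal.coe_one, mul_one, sub_zero, hv]
    have h1 : (√(1 - a))⁻¹ * (√(2 * Real.pi * (1 - a)⁻¹))⁻¹ = (√(2 * Real.pi))⁻¹ := by
      rw [Real.sqrt_mul (by positivity), Real.sqrt_inv]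
      have : √(1 - a) ≠ 0 := (Real.sqrt_pos.2 ha').ne'
      field_simp
    have h2 : -g ^ 2 / 2 + (a * g ^ 2 / 2 + b * g) =
        b ^ 2 / (2 * (1 - a)) + -(g - b / (1 - a)) ^ 2 / (2 * (1 - a)⁻¹) := by
      field_simp
      ring
    rw [mul_assoc, ← Real.exp_add, h2, Real.exp_add, ← h1]
    ring
  rw [gaussianReal_of_var_ne_zero _ one_ne_zero,
    lintegral_withDensity_eq_lintegral_mul _ (measurable_gaussianPDF _ _) (by fun_prop)]
  simp only [Pi.mul_apply, hpdf]
  rw [lintegral_const_mul _ (measurable_gaussianPDF _ _), lintegral_gaussianPDF_eq_one _ hv0, mul_one]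

/-- Exponential moment of a quadratic function of a sub-Gaussian variable, by comparison with a
Gaussian mixture of linear exponents. -/
lemma lintegral_exp_quadratic_le {Ω : Type*} [MeasurableSpace Ω] {P : Measure Ω} [SFinite P]
    {Y : Ω → ℝ} (hY : Measurable Y) {σ : ℝ} (hσ : 0 < σ)
    (hsub : ∀ s, ∫⁻ ω, ENNReal.ofReal (Real.exp (s * Y ω)) ∂P ≤
      ENNReal.ofReal (Real.exp (σ ^ 2 * s ^ 2 / 2)))
    {c : ℝ} (hc : 0 < c) (hc1 : c ≤ 1) (m : ℝ) :
    ∫⁻ ω, ENNReal.ofReal (Real.exp ((Y ω ^ 2 - c * (Y ω - m) ^ 2) / (2 * σ ^ 2))) ∂P ≤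
      ENNReal.ofReal (√c)⁻¹ := by
  have ha : 0 ≤ 1 - c := sub_nonneg.2 hc1
  -- The exponent has quadratic part `(1-c)y²/(2σ²)`, whose exponential is the mean of `exp(√(1-c) g
  -- y/σ)` over a standard Gaussian `g`; the rest is already linear in `y`. This is where `c ≤ 1`
  -- enters.
  have hmix : ∀ y : ℝ,
      ENNReal.ofReal (Real.exp ((y ^ 2 - c * (y - m) ^ 2) / (2 * σ ^ 2))) =
        ∫⁻ g, ENNReal.ofReal (Real.exp (-(c * m ^ 2 / (2 * σ ^ 2)))) *
          ENNReal.ofReal (Real.exp ((√(1 - c) / σ * g + c * m / σ ^ 2) * y))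
            ∂gaussianReal 0 1 := fun y => by
    have h := lintegral_exp_quadratic_gaussianReal zero_lt_one (√(1 - c) / σ * y)
    have h2 : ∀ g : ℝ, ENNReal.ofReal (Real.exp (-(c * m ^ 2 / (2 * σ ^ 2)))) *
        ENNReal.ofReal (Real.exp ((√(1 - c) / σ * g + c * m / σ ^ 2) * y)) =
        ENNReal.ofReal (Real.exp (c * m / σ ^ 2 * y - c * m ^ 2 / (2 * σ ^ 2))) *
          ENNReal.ofReal (Real.exp (0 * g ^ 2 / 2 + √(1 - c) / σ * y * g)) := fun g => by
      rw [← ENNReal.ofReal_mul (by positivity), ← ENNReal.ofReal_mul (by positivity),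
        ← Real.exp_add, ← Real.exp_add]
      ring_nf
    simp only [h2]
    rw [lintegral_const_mul _ (by fun_prop), h, ← ENNReal.ofReal_mul (by positivity), sub_zero,
      Real.sqrt_one, inv_one, one_mul, ← Real.exp_add, mul_pow, div_pow, Real.sq_sqrt ha]
    congr 2
    field_simp
    ring
  simp only [hmix]
  rw [lintegral_lintegral_swap (by fun_prop)]
  have hinner : ∀ g : ℝ, ∫⁻ ω, ENNReal.ofReal (Real.exp (-(c * m ^ 2 / (2 * σ ^ 2)))) *
      ENNReal.ofReal (Real.exp ((√(1 - c) / σ * g + c * m / σ ^ 2) * Y ω)) ∂P ≤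
      ENNReal.ofReal (Real.exp ((c ^ 2 - c) * m ^ 2 / (2 * σ ^ 2))) *
        ENNReal.ofReal (Real.exp ((1 - c) * g ^ 2 / 2 + √(1 - c) * c * m / σ * g)) := fun g => by
    rw [lintegral_const_mul _ (by fun_prop)]
    refine (mul_le_mul_right (hsub _) _).trans (le_of_eq ?_)
    rw [← ENNReal.ofReal_mul (by positivity), ← ENNReal.ofReal_mul (by positivity),
        ← Real.exp_add, ← Real.exp_add]
    congr 2
    have h3 : √(1 - c) ^ 2 = 1 - c := Real.sq_sqrt ha
    generalize √(1 - c) = s at h3 ⊢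
    rw [← h3]
    field_simp
    ring
  refine (lintegral_mono hinner).trans (le_of_eq ?_)
  rw [lintegral_const_mul _ (by fun_prop), lintegral_exp_quadratic_gaussianReal (by linarith),
    ← ENNReal.ofReal_mul (by positivity), sub_sub_cancel, mul_left_comm, ← Real.exp_add]
  -- The contributions of `m` cancel exactly, so the bound is the same for every predicted value.
  have h4 : (c ^ 2 - c) * m ^ 2 / (2 * σ ^ 2) + (√(1 - c) * c * m / σ) ^ 2 / (2 * c) = 0 := by
    rw [div_pow, mul_pow, mul_pow, Real.sq_sqrt ha]
    field_simp
    ring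
  rw [h4, Real.exp_zero, mul_one]

/-- Integrating out a variable `Y` that is independent of the information `𝒢`. -/
lemma lintegral_comp_le_of_indep {Ω β γ : Type*} {𝒢 mΩ : MeasurableSpace Ω} [MeasurableSpace β]
    [mγ : MeasurableSpace γ] {P : Measure Ω} [IsProbabilityMeasure P]
    (h𝒢 : 𝒢 ≤ mΩ) {Y : Ω → γ} (hY : Measurable Y) (hind : Indep (MeasurableSpace.comap Y mγ) 𝒢 P)
    {Z : Ω → β} (hZ : Measurable[𝒢] Z) {g : γ × β → ℝ≥0∞} (hg : Measurable g)
    {b : β → ℝ≥0∞} (hb : Measurable b) (hgb : ∀ z, ∫⁻ ω, g (Y ω, z) ∂P ≤ b z) :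
    ∫⁻ ω, g (Y ω, Z ω) ∂P ≤ ∫⁻ ω, b (Z ω) ∂P := by
  have hZ' : Measurable Z := hZ.mono h𝒢 le_rfl
  have hYZ : IndepFun Y Z P := by
    rw [IndepFun_iff_Indep]
    exact indep_of_indep_of_le_right hind hZ.comap_le
  rw [← lintegral_map hg (hY.prodMk hZ'), hYZ.map_prod_eq_prod_map_map hY.aemeasurable
    hZ'.aemeasurable, lintegral_prod_symm _ hg.aemeasurable, ← lintegral_map hb hZ']
  refine lintegral_mono fun z => ?_
  rw [lintegral_map (f := fun y => g (y, z)) (by fun_prop) hY]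
  exact hgb z

/-- Ville's maximal inequality for a nonnegative supermartingale with finite horizon. -/
lemma mul_measure_exists_le_le_lintegral {Ω : Type*} {mΩ : MeasurableSpace Ω} (P : Measure Ω)
    (ℱ : Filtration ℕ mΩ) (W : ℕ → Ω → ℝ≥0∞) (T : ℕ) (hW : ∀ n ≤ T, Measurable[ℱ n] (W n))
    (hstep : ∀ n < T, ∀ A, MeasurableSet[ℱ n] A → ∫⁻ ω in A, W (n + 1) ω ∂P ≤ ∫⁻ ω in A, W n ω ∂P)
    (c : ℝ≥0∞) :
    c * P {ω | ∃ n ≤ T, c ≤ W n ω} ≤ ∫⁻ ω, W 0 ω ∂P := by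
  have hset : ∀ n ≤ T, MeasurableSet[ℱ n] {ω | ∃ i ≤ n, c ≤ W i ω} := fun n hn => by
    have : {ω | ∃ i ≤ n, c ≤ W i ω} = ⋃ i ∈ Set.Iic n, {ω | c ≤ W i ω} := by ext; simp
    rw [this]
    exact MeasurableSet.biUnion (Set.to_countable _) fun i hi =>
      ℱ.mono hi _ (@measurableSet_le _ _ _ _ _ (ℱ i) _ _ _ _ _ measurable_const
        (hW i (le_trans hi hn)))
  -- This invariant replaces stopping: mass that has reached level `c` is charged `c`, the rest
  -- keeps its current integral.
  suffices h : ∀ n ≤ T, c * P {ω | ∃ i ≤ n, c ≤ W i ω} +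
      ∫⁻ ω in {ω | ∃ i ≤ n, c ≤ W i ω}ᶜ, W n ω ∂P ≤ ∫⁻ ω, W 0 ω ∂P from
    le_self_add.trans (h T le_rfl)
  have hge : ∀ (n : ℕ) (S : Set Ω), n ≤ T → (∀ ω ∈ S, c ≤ W n ω) →
      c * P S ≤ ∫⁻ ω in S, W n ω ∂P := fun n S hn hS => by
    rw [← setLIntegral_const]
    exact setLIntegral_mono ((hW n hn).mono (ℱ.le n) le_rfl) hS
  intro n
  induction n with
  | zero =>
    intro h0
    rw [← lintegral_add_compl (μ := P) (W 0) (ℱ.le 0 _ (hset 0 h0))]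
    exact add_le_add (hge 0 {ω | ∃ i ≤ 0, c ≤ W i ω} h0 fun ω ⟨i, hi, h⟩ => by
      rwa [Nat.le_zero.1 hi] at h) le_rfl
  | succ n ih =>
    intro hn
    refine le_trans ?_ (ih (Nat.le_of_succ_le hn))
    set A := {ω | ∃ i ≤ n, c ≤ W i ω} with hA
    set A' := {ω | ∃ i ≤ n + 1, c ≤ W i ω} with hA'
    have hAm := hset n (Nat.le_of_succ_le hn)
    have hAm' := ℱ.le _ _ (hset (n + 1) hn)
    have hAA' : A ⊆ A' := fun ω ⟨i, hi, h⟩ => ⟨i, hi.trans n.le_succ, h⟩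
    have hmeas : P A' ≤ P A + P (Aᶜ ∩ A') := by
      refine (measure_mono fun ω hω => ?_).trans (measure_union_le _ _)
      by_cases h : ω ∈ A
      exacts [Or.inl h, Or.inr ⟨h, hω⟩]
    have hnew : c * P (Aᶜ ∩ A') ≤ ∫⁻ ω in Aᶜ ∩ A', W (n + 1) ω ∂P := by
      refine hge _ _ hn fun ω ⟨hω, i, hi, h⟩ => ?_
      rcases Nat.le_succ_iff.1 hi with hi | rfl
      exacts [(hω ⟨i, hi, h⟩).elim, h]
    have hsplit : ∫⁻ ω in Aᶜ ∩ A', W (n + 1) ω ∂P + ∫⁻ ω in A'ᶜ, W (n + 1) ω ∂P =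
        ∫⁻ ω in Aᶜ, W (n + 1) ω ∂P := by
      rw [← lintegral_inter_add_sdiff _ Aᶜ hAm', Set.sdiff_eq,
        Set.inter_eq_right.2 (Set.compl_subset_compl.2 hAA')]
    calc c * P A' + ∫⁻ ω in A'ᶜ, W (n + 1) ω ∂P
        ≤ c * P A + (c * P (Aᶜ ∩ A') + ∫⁻ ω in A'ᶜ, W (n + 1) ω ∂P) := by
          rw [← add_assoc, ← mul_add]; gcongr
      _ ≤ c * P A + ∫⁻ ω in Aᶜ, W (n + 1) ω ∂P := by rw [← hsplit]; gcongr
      _ ≤ c * P A + ∫⁻ ω in Aᶜ, W n ω ∂P := by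
          gcongr 1; exact hstep n hn _ hAm.compl

/-! ### Measurability of the posterior quantities -/

section Measurability

variable {Ω X : Type*} {mΩ : MeasurableSpace Ω} [MeasurableSpace X] {k : X → X → ℝ}
  {x : ℕ → Ω → X} {y : ℕ → Ω → ℝ} {n : ℕ}

lemma measurable_det_of_apply {ι : Type*} [Fintype ι] [DecidableEq ι] {A : Ω → Matrix ι ι ℝ}
    (hA : ∀ i j, Measurable fun ω => A ω i j) : Measurable fun ω => (A ω).det := by
  simp only [Matrix.det_apply]
  exact Finset.measurable_sum _ fun τ _ =>
    (Finset.measurable_prod _ fun i _ => hA _ _).const_smul _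

/-- Cramer's rule; singular matrices need no separate case, as the real inverse is measurable with
`0⁻¹ = 0`. -/
lemma measurable_inv_apply {ι : Type*} [Fintype ι] [DecidableEq ι] {A : Ω → Matrix ι ι ℝ}
    (hA : ∀ i j, Measurable fun ω => A ω i j) (i j : ι) : Measurable fun ω => (A ω)⁻¹ i j := by
  simp only [Matrix.inv_def, Ring.inverse_eq_inv', Matrix.smul_apply, Matrix.adjugate_apply,
    smul_eq_mul]
  refine (measurable_det_of_apply hA).inv.mul (measurable_det_of_apply fun a b => ?_)
  by_cases h : a = j
  · simp only [h, Matrix.updateRow_self]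
    exact measurable_const
  · simp only [Matrix.updateRow_ne h]
    exact hA a b

lemma measurable_dotProduct_inv_mulVec (lam : ℝ) (hk : Measurable fun p : X × X => k p.1 p.2)
    (hx : ∀ i < n, Measurable (x i)) {u v : Ω → Fin n → ℝ} (hu : Measurable u)
    (hv : Measurable v) :
    Measurable fun ω =>
      u ω ⬝ᵥ ((kernelMatrix k (firstTerms (fun t => x t ω) n) + lam • 1)⁻¹ *ᵥ v ω) := by
  simp only [Matrix.mulVec, dotProduct]
  refine Finset.measurable_sum _ fun i _ => ((measurable_pi_apply i).comp hu).mul <|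
    Finset.measurable_sum _ fun j _ => Measurable.mul ?_ ((measurable_pi_apply j).comp hv)
  refine measurable_inv_apply (fun a b => ?_) i j
  exact (hk.comp ((hx a a.2).prodMk (hx b b.2))).add_const _

lemma measurable_kernelVec (hk : Measurable fun p : X × X => k p.1 p.2)
    (hx : ∀ i < n, Measurable (x i)) {z : Ω → X} (hz : Measurable z) :
    Measurable fun ω => kernelVec k (firstTerms (fun t => x t ω) n) (z ω) :=
  measurable_pi_lambda _ fun i => hk.comp ((hx i i.2).prodMk hz)

lemma measurable_firstTerms (hy : ∀ i < n, Measurable (y i)) :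
    Measurable fun ω => firstTerms (fun t => y t ω) n :=
  measurable_pi_lambda _ fun i => hy i i.2

lemma measurable_posteriorMean (lam : ℝ) (hk : Measurable fun p : X × X => k p.1 p.2)
    (hx : ∀ i < n, Measurable (x i)) (hy : ∀ i < n, Measurable (y i)) {z : Ω → X}
    (hz : Measurable z) :
    Measurable fun ω => posteriorMean k lam (firstTerms (fun t => x t ω) n)
      (firstTerms (fun t => y t ω) n) (z ω) :=
  measurable_dotProduct_inv_mulVec lam hk hx (measurable_kernelVec hk hx hz)
    (measurable_firstTerms hy)

lemma measurable_posteriorVar (lam : ℝ) (hk : Measurable fun p : X × X => k p.1 p.2)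
    (hx : ∀ i < n, Measurable (x i)) {z : Ω → X} (hz : Measurable z) :
    Measurable fun ω => posteriorVar k lam (firstTerms (fun t => x t ω) n) (z ω) :=
  (hk.comp (hz.prodMk hz)).sub <| measurable_dotProduct_inv_mulVec lam hk hx
    (measurable_kernelVec hk hx hz) (measurable_kernelVec hk hx hz)

lemma measurable_selfNormalizedForm (lam : ℝ) (hk : Measurable fun p : X × X => k p.1 p.2)
    (hx : ∀ i < n, Measurable (x i)) (hy : ∀ i < n, Measurable (y i)) :
    Measurable fun ω => selfNormalizedForm k lam (firstTerms (fun t => x t ω) n)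
      (firstTerms (fun t => y t ω) n) := by
  refine Measurable.sub ?_ ((measurable_dotProduct_inv_mulVec lam hk hx
    (measurable_firstTerms hy) (measurable_firstTerms hy)).const_mul lam)
  exact Finset.measurable_sum _ fun i _ => (hy i i.2).mul (hy i i.2)

end Measurability

end GPBandit

/-! ### The exponential supermartingale of the noise -/

namespace GPBandit

/-- The sum `∑_{s ≤ n} ln(1 + lam⁻¹ σ_{s-1}²(x_s))`, twice the information gain of the first
`n` points. -/
noncomputable def sumLogVar {X : Type*} (k : X → X → ℝ) (lam : ℝ) (x : ℕ → X) (n : ℕ) : ℝ :=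
  ∑ s ∈ Finset.range n, Real.log (1 + lam⁻¹ * posteriorVar k lam (firstTerms x s) (x s))

/-- The exponential process `exp(Q_n / (2 σ²)) / √det(I + lam⁻¹ K_n)`, where `Q_n` is the
self-normalized form of the noise. -/
noncomputable def noiseProcess {X : Type*} (k : X → X → ℝ) (lam σ : ℝ) (x : ℕ → X) (y : ℕ → ℝ)
    (n : ℕ) : ℝ≥0∞ :=
  ENNReal.ofReal (Real.exp (selfNormalizedForm k lam (firstTerms x n) (firstTerms y n) /
    (2 * σ ^ 2) - sumLogVar k lam x n / 2))

variable {X E : Type*} [NormedAddCommGroup E] [InnerProductSpace ℝ E]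
  {k : X → X → ℝ} {φ : X → E} {lam : ℝ}

lemma noiseProcess_succ (hk : ∀ a b, k a b = inner ℝ (φ a) (φ b)) (hlam : 0 < lam) (σ : ℝ)
    (x : ℕ → X) (y : ℕ → ℝ) (n : ℕ) :
    noiseProcess k lam σ x y (n + 1) = noiseProcess k lam σ x y n *
      (ENNReal.ofReal (√(1 + lam⁻¹ * posteriorVar k lam (firstTerms x n) (x n)))⁻¹ *
        ENNReal.ofReal (Real.exp ((y n ^ 2 - lam / (lam + posteriorVar k lam (firstTerms x n) (x n))
          * (y n - posteriorMean k lam (firstTerms x n) (firstTerms y n) (x n)) ^ 2) /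
            (2 * σ ^ 2)))) := by
  have hv := posteriorVar_nonneg hk hlam (firstTerms x n) (x n)
  have hpos : 0 < 1 + lam⁻¹ * posteriorVar k lam (firstTerms x n) (x n) := by positivity
  have hs : (√(1 + lam⁻¹ * posteriorVar k lam (firstTerms x n) (x n)))⁻¹ =
      Real.exp (-(Real.log (1 + lam⁻¹ * posteriorVar k lam (firstTerms x n) (x n)) / 2)) := by
    rw [Real.exp_neg, Real.sqrt_eq_rpow, Real.rpow_def_of_pos hpos]
    congr 2
    ring
  rw [noiseProcess, noiseProcess, selfNormalizedForm_succ hk hlam, sumLogVar, sumLogVar,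
    Finset.sum_range_succ, hs, ← ENNReal.ofReal_mul (by positivity),
    ← ENNReal.ofReal_mul (by positivity), ← Real.exp_add, ← Real.exp_add]
  congr 2
  ring

variable {Ω : Type*} {mΩ : MeasurableSpace Ω} [MeasurableSpace X] {P : Measure Ω}
  {ℱ : Filtration ℕ mΩ} {σ : ℝ≥0} {T : ℕ} {x : ℕ → Ω → X} {η : ℕ → Ω → ℝ}

lemma IsBanditProtocol.measurable_point (h : IsBanditProtocol P ℱ σ T x η) {i n : ℕ} (hin : i ≤ n)
    (hi : i < T) : Measurable[ℱ n] (x i) :=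
  (h.point_measurable i hi).mono (ℱ.mono hin) le_rfl

lemma IsBanditProtocol.measurable_noise (h : IsBanditProtocol P ℱ σ T x η) {i n : ℕ} (hin : i < n)
    (hi : i < T) : Measurable[ℱ n] (η i) :=
  (h.noise_measurable i hi).mono (ℱ.mono hin) le_rfl

lemma measurable_noiseProcess (lam : ℝ) (hkm : Measurable fun p : X × X => k p.1 p.2)
    (h : IsBanditProtocol P ℱ σ T x η) {n : ℕ} (hn : n ≤ T) :
    Measurable[ℱ n] fun ω =>
      noiseProcess k lam σ (fun t => x t ω) (fun t => η t ω) n := by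
  refine ENNReal.measurable_ofReal.comp (Real.measurable_exp.comp (Measurable.sub ?_ ?_))
  · exact (measurable_selfNormalizedForm lam hkm
      (fun i hi => h.measurable_point hi.le (hi.trans_le hn))
      (fun i hi => h.measurable_noise hi (hi.trans_le hn))).div_const _
  · refine Measurable.div_const (Finset.measurable_sum _ fun s hs => ?_) _
    have hs : s < n := Finset.mem_range.1 hs
    exact Real.measurable_log.comp (((measurable_posteriorVar lam hkm
      (fun i hi => h.measurable_point (hi.trans hs).le ((hi.trans hs).trans_le hn))
      (h.measurable_point hs.le (hs.trans_le hn))).const_mul _).const_add _)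

lemma IsBanditProtocol.lintegral_exp_noise_le (h : IsBanditProtocol P ℱ σ T x η) {n : ℕ}
    (hn : n < T) (s : ℝ) :
    ∫⁻ ω, ENNReal.ofReal (Real.exp (s * η n ω)) ∂P ≤
      ENNReal.ofReal (Real.exp ((σ : ℝ) ^ 2 * s ^ 2 / 2)) := by
  have hsub := h.noise_subGaussian n hn
  rw [← ofReal_integral_eq_lintegral_ofReal (hsub.integrable_exp_mul s)
    (Filter.Eventually.of_forall fun ω => (Real.exp_pos _).le)]
  exact ENNReal.ofReal_le_ofReal (by simpa [mgf] using hsub.mgf_le s)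

/-- Supermartingale property, tested on past events `A`: with the past frozen, the moment bound
`1/√c` for the fresh noise cancels the normalizer `1/√(1 + v/λ)`. -/
lemma setLIntegral_noiseProcess_succ_le [IsProbabilityMeasure P]
    (hk : ∀ a b, k a b = inner ℝ (φ a) (φ b))
    (hlam : 0 < lam) (hkm : Measurable fun p : X × X => k p.1 p.2) (hσ : 0 < σ)
    (h : IsBanditProtocol P ℱ σ T x η) {n : ℕ} (hn : n < T) {A : Set Ω}
    (hA : MeasurableSet[ℱ n] A) :
    ∫⁻ ω in A, noiseProcess k lam σ (fun t => x t ω) (fun t => η t ω) (n + 1) ∂P ≤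
      ∫⁻ ω in A, noiseProcess k lam σ (fun t => x t ω) (fun t => η t ω) n ∂P := by
  set W : ℕ → Ω → ℝ≥0∞ := fun n ω => noiseProcess k lam σ (fun t => x t ω) (fun t => η t ω) n
    with hW
  have hη : Measurable (η n) := (h.noise_measurable n hn).mono (ℱ.le _) le_rfl
  have hxm : ∀ i < n, Measurable[ℱ n] (x i) := fun i hi => h.measurable_point hi.le (hi.trans hn)
  have hηm : ∀ i < n, Measurable[ℱ n] (η i) := fun i hi => h.measurable_noise hi (hi.trans hn)
  -- All that the next step needs from the past. The event `A` is folded into the first component,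
  -- and a variance in `ℝ≥0` ensures `0 < c ≤ 1` for every value of `z`, not only for attained ones.
  let Z : Ω → ℝ≥0∞ × ℝ × ℝ≥0 := fun ω => (A.indicator (W n) ω,
    posteriorMean k lam (firstTerms (fun t => x t ω) n) (firstTerms (fun t => η t ω) n) (x n ω),
    (posteriorVar k lam (firstTerms (fun t => x t ω) n) (x n ω)).toNNReal)
  have hZ : Measurable[ℱ n] Z :=
    ((measurable_noiseProcess lam hkm h hn.le).indicator hA).prodMk <|
      (measurable_posteriorMean lam hkm hxm hηm (h.point_measurable n hn)).prodMk <|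
        (measurable_posteriorVar lam hkm hxm (h.point_measurable n hn)).real_toNNReal
  let g : ℝ × ℝ≥0∞ × ℝ × ℝ≥0 → ℝ≥0∞ := fun p => p.2.1 *
    (ENNReal.ofReal (√(1 + lam⁻¹ * (p.2.2.2 : ℝ)))⁻¹ *
      ENNReal.ofReal (Real.exp ((p.1 ^ 2 - lam / (lam + (p.2.2.2 : ℝ)) * (p.1 - p.2.2.1) ^ 2) /
        (2 * (σ : ℝ) ^ 2))))
  have hg : Measurable g := by fun_prop
  have hgb : ∀ z : ℝ≥0∞ × ℝ × ℝ≥0, ∫⁻ ω, g (η n ω, z) ∂P ≤ z.1 := by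
    rintro ⟨w, m, v⟩
    have hc : 0 < lam / (lam + (v : ℝ)) := by positivity
    have hc1 : lam / (lam + (v : ℝ)) ≤ 1 := div_le_one_of_le₀ (by simp) (by positivity)
    have hone : ENNReal.ofReal (√(1 + lam⁻¹ * (v : ℝ)))⁻¹ *
        ENNReal.ofReal (√(lam / (lam + (v : ℝ))))⁻¹ = 1 := by
      rw [← ENNReal.ofReal_mul (by positivity), ← mul_inv, ← Real.sqrt_mul (by positivity)]
      have : (1 + lam⁻¹ * (v : ℝ)) * (lam / (lam + v)) = 1 := by field_simp
      rw [this]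
      simp
    have hquad := lintegral_exp_quadratic_le hη (NNReal.coe_pos.2 hσ)
      (h.lintegral_exp_noise_le hn) hc hc1 m
    simp only [g]
    rw [lintegral_const_mul _ (by fun_prop), lintegral_const_mul _ (by fun_prop)]
    calc _ ≤ w * (ENNReal.ofReal (√(1 + lam⁻¹ * (v : ℝ)))⁻¹ *
          ENNReal.ofReal (√(lam / (lam + (v : ℝ))))⁻¹) := by gcongr
      _ = w := by rw [hone, mul_one]
  have key := lintegral_comp_le_of_indep (ℱ.le n) hη (h.noise_indep n hn) hZ hg measurable_fst hgb
  rw [← lintegral_indicator (ℱ.le n _ hA), ← lintegral_indicator (ℱ.le n _ hA)]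
  refine (le_of_eq (lintegral_congr fun ω => ?_)).trans key
  simp only [g, Z]
  by_cases hω : ω ∈ A
  · rw [Set.indicator_of_mem hω, Set.indicator_of_mem hω, hW,
      Real.coe_toNNReal _ (posteriorVar_nonneg hk hlam _ _)]
    exact noiseProcess_succ hk hlam _ _ _ _
  · rw [Set.indicator_of_notMem hω, Set.indicator_of_notMem hω, zero_mul]

/-- Self-normalized concentration of the noise, uniformly over the rounds. -/
theorem ofReal_one_sub_le_measure_selfNormalizedForm_le [IsProbabilityMeasure P]
    (hk : ∀ a b, k a b = inner ℝ (φ a) (φ b)) (hlam : 0 < lam)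
    (hkm : Measurable fun p : X × X => k p.1 p.2)
    (h : IsBanditProtocol P ℱ σ T x η) {δ : ℝ} (hδ : 0 < δ) :
    ENNReal.ofReal (1 - δ) ≤ P {ω | ∀ n ≤ T,
      selfNormalizedForm k lam (firstTerms (fun t => x t ω) n) (firstTerms (fun t => η t ω) n) ≤
        (σ : ℝ) ^ 2 * (2 * Real.log (1 / δ) + sumLogVar k lam (fun t => x t ω) n)} := by
  -- The process divides by `σ²`, so `σ = 0` is separate: the noise then vanishes almost surely.
  rcases eq_or_ne σ 0 with rfl | hσ
  · have hzero : ∀ᵐ ω ∂P, ∀ t < T, η t ω = 0 := by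
      refine ae_all_iff.2 fun t => ?_
      by_cases ht : t < T
      · have := h.noise_subGaussian t ht
        rw [zero_pow two_ne_zero] at this
        filter_upwards [this.ae_eq_zero_of_hasSubgaussianMGF_zero] with ω hω _ using hω
      · exact Filter.Eventually.of_forall fun ω ht' => (ht ht').elim
    refine le_trans ?_ (measure_mono (μ := P) (s := {ω | ∀ t < T, η t ω = 0}) fun ω hω n hn => ?_)
    · rw [measure_eq_measure_of_null_sdiff (Set.subset_univ _) (by rwa [← Set.compl_eq_univ_sdiff]),
        measure_univ]
      exact ENNReal.ofReal_le_one.2 (sub_le_self _ hδ.le)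
    · have : firstTerms (fun t => η t ω) n = 0 := funext fun i => hω i (i.2.trans_le hn)
      simp [selfNormalizedForm, this]
  · have hσ : 0 < σ := pos_iff_ne_zero.2 hσ
    have hσ' : (0 : ℝ) < σ := hσ
    have hville := mul_measure_exists_le_le_lintegral P ℱ
      (fun n ω => noiseProcess k lam σ (fun t => x t ω) (fun t => η t ω) n) T
      (fun n hn => measurable_noiseProcess lam hkm h hn)
      (fun n hn A hA => setLIntegral_noiseProcess_succ_le hk hlam hkm hσ h hn hA)
      (ENNReal.ofReal (1 / δ))
    have hzero : ∫⁻ ω, noiseProcess k lam σ (fun t => x t ω) (fun t => η t ω) 0 ∂P = 1 := by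
      simp [noiseProcess, selfNormalizedForm, sumLogVar]
    rw [hzero] at hville
    set S := {ω | ∃ n ≤ T, ENNReal.ofReal (1 / δ) ≤
      noiseProcess k lam σ (fun t => x t ω) (fun t => η t ω) n} with hS
    have hPS : P S ≤ ENNReal.ofReal δ := by
      have h1 : ENNReal.ofReal δ * (ENNReal.ofReal (1 / δ) * P S) = P S := by
        rw [← mul_assoc, ← ENNReal.ofReal_mul hδ.le, mul_one_div_cancel hδ.ne', ENNReal.ofReal_one,
          one_mul]
      rw [← h1]
      simpa using mul_le_mul_right hville (ENNReal.ofReal δ)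
    rw [ENNReal.ofReal_sub _ hδ.le, ENNReal.ofReal_one, tsub_le_iff_right]
    refine le_trans ?_ (add_le_add le_rfl hPS)
    rw [← measure_univ (μ := P)]
    refine (measure_mono fun ω _ => ?_).trans (measure_union_le _ _)
    rw [Set.mem_union, or_iff_not_imp_right]
    intro hω n hn
    by_contra! hlt
    refine hω ⟨n, hn, ENNReal.ofReal_le_ofReal ?_⟩
    rw [← Real.exp_log (one_div_pos.2 hδ)]
    refine Real.exp_le_exp.2 ?_
    rw [le_sub_iff_add_le, le_div_iff₀ (by positivity)]
    linarith

end GPBandit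

/-! ### Information gain, confidence bound and regret -/

namespace GPBandit

variable {X E : Type*} [NormedAddCommGroup E] [InnerProductSpace ℝ E]
  {k : X → X → ℝ} {φ : X → E} {lam : ℝ}

lemma sumLogVar_mono (hk : ∀ a b, k a b = inner ℝ (φ a) (φ b)) (hlam : 0 < lam) (x : ℕ → X) :
    Monotone (sumLogVar k lam x) := by
  refine monotone_nat_of_le_succ fun n => ?_
  rw [sumLogVar, sumLogVar, Finset.sum_range_succ, le_add_iff_nonneg_right]
  have := posteriorVar_nonneg hk hlam (firstTerms x n) (x n)
  exact Real.log_nonneg (le_add_of_nonneg_right (by positivity))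

lemma sumLogVar_nonneg (hk : ∀ a b, k a b = inner ℝ (φ a) (φ b)) (hlam : 0 < lam) (x : ℕ → X)
    (n : ℕ) : 0 ≤ sumLogVar k lam x n := by
  simpa [sumLogVar] using sumLogVar_mono hk hlam x (Nat.zero_le n)

/-- Each summand is at most `λ⁻¹`, by `ln(1 + u) ≤ u` and `v ≤ 1`. Boundedness makes the real `⨆` in
`maxInfoGain` a genuine supremum. -/
lemma bddAbove_infoGain [Nonempty X] (hk : ∀ a b, k a b = inner ℝ (φ a) (φ b)) (hlam : 0 < lam)
    (hk1 : ∀ a, k a a ≤ 1) (n : ℕ) :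
    BddAbove (Set.range fun z : Fin n → X =>
      (1 / 2 : ℝ) * Real.log (1 + lam⁻¹ • kernelMatrix k z : Matrix (Fin n) (Fin n) ℝ).det) := by
  refine ⟨1 / 2 * (n * lam⁻¹), ?_⟩
  rintro _ ⟨z, rfl⟩
  obtain ⟨x, rfl⟩ : ∃ x : ℕ → X, firstTerms x n = z :=
    ⟨fun i => if h : i < n then z ⟨i, h⟩ else Classical.arbitrary X, by ext i; simp [firstTerms]⟩
  refine mul_le_mul_of_nonneg_left ?_ (by norm_num)
  rw [log_det_one_add_eq_sum hk hlam]
  refine (Finset.sum_le_card_nsmul _ _ lam⁻¹ fun s _ => ?_).trans (by simp)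
  have h0 := posteriorVar_nonneg hk hlam (firstTerms x s) (x s)
  have h1 := (posteriorVar_le hk hlam (firstTerms x s) (x s)).trans (hk1 _)
  have hinv := inv_pos.2 hlam
  have := Real.log_le_sub_one_of_pos
    (show 0 < 1 + lam⁻¹ * posteriorVar k lam (firstTerms x s) (x s) by positivity)
  nlinarith

lemma sumLogVar_le_two_mul_maxInfoGain (hk : ∀ a b, k a b = inner ℝ (φ a) (φ b)) (hlam : 0 < lam)
    (hk1 : ∀ a, k a a ≤ 1) (x : ℕ → X) (n : ℕ) :
    sumLogVar k lam x n ≤ 2 * maxInfoGain k lam n := by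
  have : Nonempty X := ⟨x 0⟩
  have h := le_ciSup (bddAbove_infoGain hk hlam hk1 n) (firstTerms x n)
  simp only [log_det_one_add_eq_sum hk hlam] at h
  rw [sumLogVar, maxInfoGain]
  linarith

/-- Termwise, `ln(1 + v/λ) ≥ 1 - (1 + v/λ)⁻¹ = v/(λ + v)`, and `v ≤ 1` bounds the denominator by `λ
+ 1`. -/
lemma sum_posteriorVar_le (hk : ∀ a b, k a b = inner ℝ (φ a) (φ b)) (hlam : 0 < lam)
    (hk1 : ∀ a, k a a ≤ 1) (x : ℕ → X) (n : ℕ) :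
    ∑ s ∈ Finset.range n, posteriorVar k lam (firstTerms x s) (x s) ≤
      (lam + 1) * sumLogVar k lam x n := by
  rw [sumLogVar, Finset.mul_sum]
  refine Finset.sum_le_sum fun s _ => ?_
  have h0 := posteriorVar_nonneg hk hlam (firstTerms x s) (x s)
  have h1 := (posteriorVar_le hk hlam (firstTerms x s) (x s)).trans (hk1 _)
  generalize posteriorVar k lam (firstTerms x s) (x s) = v at h0 h1
  have hpos : 0 < 1 + lam⁻¹ * v := by positivity
  have hlog := Real.one_sub_inv_le_log_of_pos hpos
  refine le_trans ?_ (mul_le_mul_of_nonneg_left hlog (by positivity))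
  have h2 : 1 - (1 + lam⁻¹ * v)⁻¹ = v / (lam + v) := by field_simp; ring
  rw [h2, ← mul_div_assoc, le_div_iff₀ (by positivity)]
  nlinarith

/-- The confidence bound behind the enlarged confidence width: it holds whenever the noise is
controlled in the self-normalized sense. -/
lemma abs_posteriorMean_sub_le (hk : ∀ a b, k a b = inner ℝ (φ a) (φ b)) (hlam : 0 < lam)
    {σ B δ ε : ℝ} (hσ : 0 ≤ σ) (hε : 0 ≤ ε) {f : E} (hf : ‖f‖ ≤ B) {fstar : X → ℝ}
    (hfstar : ∀ z, |inner ℝ f (φ z) - fstar z| ≤ ε) (x : ℕ → X) (e : ℕ → ℝ) (n : ℕ)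
    (he : selfNormalizedForm k lam (firstTerms x n) (firstTerms e n) ≤
      σ ^ 2 * (2 * Real.log (1 / δ) + sumLogVar k lam x n)) (z : X) :
    |posteriorMean k lam (firstTerms x n) (firstTerms (fun t => fstar (x t) + e t) n) z -
        inner ℝ f (φ z)| ≤
      (confidenceParam k lam σ B δ x n + ε * √((n : ℝ) + 1) / √lam) *
        posteriorStd k lam (firstTerms x n) z := by
  -- Observations are signal in the Hilbert space, plus misspecification, plus noise.
  have hsplit : posteriorMean k lam (firstTerms x n)
      (firstTerms (fun t => fstar (x t) + e t) n) z =
      posteriorMean k lam (firstTerms x n) (fun i => inner ℝ f (φ (firstTerms x n i))) z +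
      posteriorMean k lam (firstTerms x n)
        (fun i => fstar (firstTerms x n i) - inner ℝ f (φ (firstTerms x n i))) z +
      posteriorMean k lam (firstTerms x n) (firstTerms e n) z := by
    simp only [posteriorMean_eq_weights hk, ← dotProduct_add]
    congr 1
    ext i
    simp [firstTerms]
  have h1 := abs_posteriorMean_inner_sub_le hk hlam (firstTerms x n) f z
  have h2 := abs_posteriorMean_le_of_abs_le hk hlam (firstTerms x n)
    (fun i => fstar (firstTerms x n i) - inner ℝ f (φ (firstTerms x n i))) hε
    (fun i => by rw [abs_sub_comm]; exact hfstar _) z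
  have h3 := abs_posteriorMean_le hk hlam (firstTerms x n) (firstTerms e n) z
  have hstd : 0 ≤ posteriorStd k lam (firstTerms x n) z := Real.sqrt_nonneg _
  have h1' : ‖f‖ * posteriorStd k lam (firstTerms x n) z ≤
      B * posteriorStd k lam (firstTerms x n) z := by gcongr
  have h2' : ε * √n / √lam * posteriorStd k lam (firstTerms x n) z ≤
      ε * √((n : ℝ) + 1) / √lam * posteriorStd k lam (firstTerms x n) z := by
    gcongr
    linarith
  have h3' : √(selfNormalizedForm k lam (firstTerms x n) (firstTerms e n)) / √lam *
      posteriorStd k lam (firstTerms x n) z ≤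
      σ / √lam * √(2 * Real.log (1 / δ) + sumLogVar k lam x n) *
        posteriorStd k lam (firstTerms x n) z := by
    refine mul_le_mul_of_nonneg_right ?_ hstd
    rw [div_mul_eq_mul_div]
    refine div_le_div_of_nonneg_right ((Real.sqrt_le_sqrt he).trans (le_of_eq ?_))
      (Real.sqrt_nonneg _)
    rw [Real.sqrt_mul (sq_nonneg σ), Real.sqrt_sq hσ]
  rw [hsplit, confidenceParam, ← sumLogVar, add_mul, add_mul]
  rw [abs_le] at h1 h2 h3 ⊢
  constructor <;> linarith

/-- Regret bound for a run of EC-GP-UCB on the event that the noise is controlled in the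
self-normalized sense. -/
lemma cumRegret_le_of_selfNormalizedForm_le (hk : ∀ a b, k a b = inner ℝ (φ a) (φ b))
    (hlam : 0 < lam) (hk1 : ∀ a, k a a ≤ 1) {σ B δ ε : ℝ} (hσ : 0 ≤ σ) (hB : 0 ≤ B)
    (hε : 0 ≤ ε) {f : E} (hf : ‖f‖ ≤ B) {fstar : X → ℝ}
    (hfstar : ∀ z, |inner ℝ f (φ z) - fstar z| ≤ ε) (x : ℕ → X) (e : ℕ → ℝ) (T : ℕ)
    (he : ∀ n ≤ T, selfNormalizedForm k lam (firstTerms x n) (firstTerms e n) ≤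
      σ ^ 2 * (2 * Real.log (1 / δ) + sumLogVar k lam x n))
    (hrun : IsECGPUCBRun k lam σ B δ ε T x fun t => fstar (x t) + e t) :
    cumRegret (fun z => inner ℝ f (φ z)) x T ≤
      2 * (σ / √lam * √(2 * (Real.log (1 / δ) + maxInfoGain k lam T)) + B + ε * √T / √lam) *
        √(2 * (lam + 1) * (maxInfoGain k lam T * T)) := by
  have : Nonempty X := ⟨x 0⟩
  have hS := sumLogVar_le_two_mul_maxInfoGain hk hlam hk1 x T
  set w := σ / √lam * √(2 * (Real.log (1 / δ) + maxInfoGain k lam T)) + B + ε * √T / √lam with hw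
  have hw0 : 0 ≤ w := by positivity
  have hround : ∀ n ∈ Finset.range T, (⨆ z : X, inner ℝ f (φ z)) - inner ℝ f (φ (x n)) ≤
      2 * w * posteriorStd k lam (firstTerms x n) (x n) := fun n hn => by
    rw [Finset.mem_range] at hn
    have hconf := abs_posteriorMean_sub_le hk hlam hσ hε hf hfstar x e n (he n hn.le)
    -- Optimism: the index dominates `f` at every point, and the selected point maximizes the index.
    have hsup : ⨆ z : X, inner ℝ f (φ z) ≤ enlargedUCB k lam σ B δ ε x
        (fun t => fstar (x t) + e t) n (x n) := by
      refine ciSup_le fun z => le_trans ?_ (hrun n hn z)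
      have := (abs_le.1 (hconf z)).1
      rw [enlargedUCB]
      linarith
    have hlow := (abs_le.1 (hconf (x n))).2
    have hwidth : confidenceParam k lam σ B δ x n + ε * √((n : ℝ) + 1) / √lam ≤ w := by
      rw [confidenceParam, ← sumLogVar, hw]
      have h1 := (sumLogVar_mono hk hlam x hn.le).trans hS
      -- Rounds are counted from 0, so the factor `√(n+1)` of the last round is exactly `√T`.
      have h2 : (n : ℝ) + 1 ≤ T := by exact_mod_cast hn
      gcongr
      linarith
    have := mul_le_mul_of_nonneg_right hwidth
      (Real.sqrt_nonneg (posteriorVar k lam (firstTerms x n) (x n)))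
    rw [enlargedUCB] at hsup
    rw [← posteriorStd] at this
    linarith
  refine (Finset.sum_le_sum hround).trans ?_
  rw [← Finset.mul_sum]
  refine mul_le_mul_of_nonneg_left ?_ (by positivity)
  -- Cauchy–Schwarz over the rounds passes from standard deviations to variances.
  apply Real.le_sqrt_of_sq_le
  refine sq_sum_le_card_mul_sum_sq.trans ?_
  have hsq : ∑ s ∈ Finset.range T, posteriorStd k lam (firstTerms x s) (x s) ^ 2 =
      ∑ s ∈ Finset.range T, posteriorVar k lam (firstTerms x s) (x s) :=
    Finset.sum_congr rfl fun s _ => Real.sq_sqrt (posteriorVar_nonneg hk hlam _ _)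
  rw [hsq, Finset.card_range]
  have h1 := (sum_posteriorVar_le hk hlam hk1 x T).trans
    (mul_le_mul_of_nonneg_left hS (by positivity))
  refine (mul_le_mul_of_nonneg_left h1 T.cast_nonneg).trans (le_of_eq (by ring))

end GPBandit

/-! ### The main theorem -/

theorem mainTheorem1 (σ : ℝ≥0) (lam : ℝ) (hlam : 0 < lam) :
    ∃ C : ℝ, 0 < C ∧
      ∀ (d : ℕ) (D : Set (EuclideanSpace ℝ (Fin d))) (_ : IsCompact D)
        (k : D → D → ℝ) (_ : Measurable fun p : D × D => k p.1 p.2) (_ : ∀ x, k x x ≤ 1)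
        (H : Type*) [NormedAddCommGroup H] [InnerProductSpace ℝ H] [CompleteSpace H]
        [RKHS ℝ H D ℝ] (_ : GPBandit.IsRKHSOf k H)
        (B : ℝ) (_ : 0 < B) (ε : ℝ) (_ : 0 ≤ ε) (δ : ℝ) (_ : 0 < δ) (_ : δ < 1)
        (fstar : D → ℝ) (f : H) (_ : f ∈ GPBandit.hypothesisClass H B)
        (_ : ∀ z : D, |f z - fstar z| ≤ ε)
        (Ω : Type*) [mΩ : MeasurableSpace Ω] (P : Measure Ω) [IsProbabilityMeasure P]
        (ℱ : Filtration ℕ mΩ) (T : ℕ) (x : ℕ → Ω → D) (η : ℕ → Ω → ℝ)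
        (_ : GPBandit.IsBanditProtocol P ℱ σ T x η)
        (_ : ∀ ω, GPBandit.IsECGPUCBRun k lam σ B δ ε T (fun t => x t ω)
          (fun t => fstar (x t ω) + η t ω)),
        ENNReal.ofReal (1 - δ) ≤
          P {ω | GPBandit.cumRegret (fun z => f z) (fun t => x t ω) T ≤
            C * (B * √(GPBandit.maxInfoGain k lam T * T) +
              √((Real.log (1 / δ) + GPBandit.maxInfoGain k lam T) *
                GPBandit.maxInfoGain k lam T * T) +
              ε * T * √(GPBandit.maxInfoGain k lam T))} := by
  -- The first factor comes from the Cauchy–Schwarz step; the second is the sum of the coefficients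
  -- of `B`, `√(L + γ)` and `ε√T` in the confidence width, hence at least each of them.
  refine ⟨2 * √(2 * (lam + 1)) * (1 + √2 * σ / √lam + 1 / √lam), by positivity, ?_⟩
  intro d D _ k hkm hk1 H _ _ _ _ hH B hB ε hε δ hδ hδ1 fstar f hf hfstar Ω _ P _ ℱ T x η hprot hrun
  -- The feature map is `φ a = k(a, ·)`, the kernel section at `a`.
  have hk : ∀ a b, k a b = inner ℝ (RKHS.kerFun H a 1) (RKHS.kerFun H b 1) := fun a b => by
    rw [real_inner_comm, ← RKHS.kernel_inner, hH]
    simp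
  have hfφ : ∀ z, inner ℝ f (RKHS.kerFun H z 1) = f z := fun z => by
    rw [RKHS.inner_kerFun]
    simp
  refine (GPBandit.ofReal_one_sub_le_measure_selfNormalizedForm_le hk hlam hkm hprot hδ).trans
    (measure_mono fun ω hω => ?_)
  have hreg := GPBandit.cumRegret_le_of_selfNormalizedForm_le hk hlam hk1 σ.coe_nonneg hB.le hε hf
    (fun z => by rw [hfφ]; exact hfstar z) (fun t => x t ω) (fun t => η t ω) T hω (hrun ω)
  simp only [hfφ] at hreg
  refine hreg.trans ?_
  have hγ : 0 ≤ GPBandit.maxInfoGain k lam T := by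
    have h1 := GPBandit.sumLogVar_le_two_mul_maxInfoGain hk hlam hk1 (fun t => x t ω) T
    have h2 := GPBandit.sumLogVar_nonneg hk hlam (fun t => x t ω) T
    linarith
  have hL : 0 ≤ Real.log (1 / δ) := Real.log_nonneg (by rw [le_div_iff₀ hδ]; linarith)
  generalize GPBandit.maxInfoGain k lam T = γ at hγ
  generalize Real.log (1 / δ) = L at hL
  have e1 : √((L + γ) * γ * T) = √(L + γ) * √(γ * T) := by
    rw [mul_assoc, Real.sqrt_mul (by positivity)]
  have e2 : ε * T * √γ = ε * √T * √(γ * T) := by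
    rw [Real.sqrt_mul hγ]
    linear_combination (-ε * √γ) * Real.mul_self_sqrt (T.cast_nonneg (α := ℝ))
  rw [e1, e2, Real.sqrt_mul (by positivity) (γ * T), Real.sqrt_mul (by positivity) (L + γ)]
  have hp : 0 ≤ √2 * (σ : ℝ) / √lam := by positivity
  have hq : 0 ≤ 1 / √lam := by positivity
  have key : (σ : ℝ) / √lam * (√2 * √(L + γ)) + B + ε * √T / √lam ≤
      (1 + √2 * σ / √lam + 1 / √lam) * (B + √(L + γ) + ε * √T) := by
    have e3 : (σ : ℝ) / √lam * (√2 * √(L + γ)) + B + ε * √T / √lam =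
        √2 * σ / √lam * √(L + γ) + B + 1 / √lam * (ε * √T) := by ring
    rw [e3]
    generalize √2 * (σ : ℝ) / √lam = p at hp
    generalize 1 / √lam = q at hq
    have h1 : 0 ≤ √(L + γ) := Real.sqrt_nonneg _
    have h2 : 0 ≤ ε * √T := by positivity
    nlinarith [mul_nonneg hp hB.le, mul_nonneg hq hB.le, mul_nonneg hp h2, mul_nonneg hq h1]
  have hr : 0 ≤ 2 * (√(2 * (lam + 1)) * √(γ * T)) := by positivity
  have := mul_le_mul_of_nonneg_right key hr
  exact (le_of_eq (by ring)).trans (this.trans (le_of_eq (by ring)))
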